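/- **Terms.** Terms, considered up to renaming of bound variables, are given by $M ::= x \mid \mathtt 0 \mid \mathtt 1 \mid \lambda x.M \mid MM \mid \mathtt{if}\ M\ \mathtt{then}\ M\ \mathtt{else}\ M$, where $x$ ranges over a countable set of variables; $\mathtt 0$ ("true") and $\mathtt 1$ ("false") are the booleans, and $\mathtt b$ ranges over them. The relation $\to$ is the contextual closure (under all term constructors) of $(\lambda x.M)N\to M[N/x]$, $\ \mathtt{if}\ \mathtt 0\ \mathtt{then}\ M\ \mathtt{else}\ N\to M$, $\ \mathtt{if}\ \mathtt 1\ \mathtt{then}\ M\ \mathtt{else}\ N\to N$, and $\to^*$ is its reflexive transitive closure. **Types.** Linear types are $A::=\mathbf B\mid\alpha\mid\sigma\multimap A\mid\forall\alpha.A$ and types are $\sigma::=A\mid{!\sigma}$. A context $\Gamma$ is a set of assumptions $x:\sigma$ with distinct variables; $\Gamma\#\Delta$ means that the domains are disjoint, and ${!\Gamma}$ puts a $!$ in front of every type of $\Gamma$. Judgements $\Gamma\vdash M:\sigma$ are derived by the following rules ($A$, $B$ linear, $\sigma$, $\tau$ arbitrary types): - $x:A\vdash x:A$; $\ \vdash\mathtt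 0:\mathbf B$; $\ \vdash\mathtt 1:\mathbf B$; - from $\Gamma\vdash M:\sigma$ infer $\Gamma,x:A\vdash M:\sigma$; - from $\Gamma,x:\sigma\vdash M:A$ infer $\Gamma\vdash\lambda x.M:\sigma\multimap A$; - from $\Gamma\vdash M:\sigma\multimap A$, $\Delta\vdash N:\sigma$ and $\Gamma\#\Delta$ infer $\Gamma,\Delta\vdash MN:A$; - from $\Gamma,x_1:\sigma,\dots,x_n:\sigma\vdash M:\tau$ infer $\Gamma,x:{!\sigma}\vdash M[x/x_1,\dots,x/x_n]:\tau$ ($n\ge 0$); - from $\Gamma\vdash M:\sigma$ infer ${!\Gamma}\vdash M:{!\sigma}$; - from $\Gamma\vdash M:\forall\alpha.B$ infer $\Gamma\vdash M:B[A/\alpha]$; - from $\Gamma\vdash M:A$ infer $\Gamma\vdash M:\forall\alpha.A$ if $\alpha$ is not free in $\Gamma$; - from $\Gamma\vdash M:\mathbf B$, $\Gamma\vdash N_0:A$ and $\Gamma\vdash N_1:A$ infer $\Gamma\vdash\mathtt{if}\ M\ \mathtt{then}\ N_0\ \mathtt{else}\ N_1:A$. A *program* is a term $M$ with $\vdash M:\mathbf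 B$ (empty context); it is then closed. **Machine.** An m-context $\mathcal A$ is a finite sequence of assignments $x:=N$ of terms to distinct variables; $\varepsilon$ is the empty one and $@$ is concatenation. $\mathbf B$-contexts are $\mathcal C::=\circ\mid(\mathtt{if}\ \mathcal C\ \mathtt{then}\ M\ \mathtt{else}\ N)V_1\cdots V_n$ ($n\ge 0$). The evaluation relation $\mathcal C,\mathcal A\models M\Downarrow\mathtt b$ is inductively defined by the following rules ($m\ge 0$): - $\mathcal C,\mathcal A\models\mathtt b\Downarrow\mathtt b$; - if $\mathcal C,\mathcal A@\{x':=N\}\models M[x'/x]V_1\cdots V_m\Downarrow\mathtt b$, where $x'$ is fresh (it occurs neither in $\mathcal C$, nor in $\mathcal A$, nor free in the term below), then $\mathcal C,\mathcal A\models(\lambda x.M)NV_1\cdots V_m\Downarrow\mathtt b$; - if $\{x:=N\}\in\mathcal A$ and $\mathcal C,\mathcal A\models NV_1\cdots V_m\Downarrow\mathtt b$, then $\mathcal C,\mathcal A\models xV_1\cdots V_m\Downarrow\mathtt b$; - for $i\in\{0,1\}$, with $\mathtt i$ the corresponding boolean: if $\mathcal C[(\mathtt{if}\ \circ\ \mathtt{then}\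 N_0\ \mathtt{else}\ N_1)V_1\cdots V_m],\mathcal A\models M\Downarrow\mathtt i$ and $\mathcal C,\mathcal A\models N_iV_1\cdots V_m\Downarrow\mathtt b$, then $\mathcal C,\mathcal A\models(\mathtt{if}\ M\ \mathtt{then}\ N_0\ \mathtt{else}\ N_1)V_1\cdots V_m\Downarrow\mathtt b$. Write $\models M\Downarrow\mathtt b$ for $\circ,\varepsilon\models M\Downarrow\mathtt b$. **Theorem** (soundness and completeness of the machine). Let $M$ be a program and $\mathtt b$ a boolean. Then: 1. (Soundness) if $\models M\Downarrow\mathtt b$, then $M\to^*\mathtt b$; 2. (Completeness) if $M\to^*\mathtt b$, then $\models M\Downarrow\mathtt b$. -/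

import Mathlib

namespace STAB

/-! ### Terms, modulo renaming of bound variables -/

/-- The booleans: `zero` stands for "true", `one` for "false". -/
inductive BConst : Type
  | zero : BConst
  | one : BConst

/-- `Tm n` are the bodies found below `n` binders. Free variables are names `fvar x` (`x : ℕ`), bound
variables are de Bruijn indices `bvar i` with `i < n` (`0` is the innermost binder), so that terms that
differ in the names of bound variables are equal. -/
inductive Tm : ℕ → Type
  | fvar {n : ℕ} (x : ℕ) : Tm n
  | bvar {n : ℕ} (i : Fin n) : Tm n
  | cst {n : ℕ} (b : BConst) : Tm n
  | lam {n : ℕ} (M : Tm (n + 1)) : Tm n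
  | app {n : ℕ} (M N : Tm n) : Tm n
  | ifte {n : ℕ} (M N₀ N₁ : Tm n) : Tm n

/-- The terms `Λ_B`: no dangling bound variable; names may occur free. -/
abbrev Term : Type := Tm 0

/-- The set of (names of) free variables. -/
def Tm.FV : {n : ℕ} → Tm n → Finset ℕ
  | _, .fvar x => {x}
  | _, .bvar _ => ∅
  | _, .cst _ => ∅
  | _, .lam M => M.FV
  | _, .app M N => M.FV ∪ N.FV
  | _, .ifte M N₀ N₁ => M.FV ∪ N₀.FV ∪ N₁.FV

/-- Renaming of the bound variables. -/
def Tm.rename : {n m : ℕ} → (Fin n → Fin m) → Tm n → Tm m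
  | _, _, _, .fvar x => .fvar x
  | _, _, ρ, .bvar i => .bvar (ρ i)
  | _, _, _, .cst b => .cst b
  | n, m, ρ, .lam M =>
      .lam (M.rename (Fin.cons 0 (fun i => (ρ i).succ) : Fin (n + 1) → Fin (m + 1)))
  | _, _, ρ, .app M N => .app (M.rename ρ) (N.rename ρ)
  | _, _, ρ, .ifte M N₀ N₁ => .ifte (M.rename ρ) (N₀.rename ρ) (N₁.rename ρ)

/-- The same term, placed below one more binder. -/
def Tm.weaken {n : ℕ} (M : Tm n) : Tm (n + 1) := M.rename Fin.succ

/-- Simultaneous capture-free substitution: each free name `x` becomes `f x`, each index `i`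
becomes `g i`. -/
def Tm.bind : {n m : ℕ} → (ℕ → Tm m) → (Fin n → Tm m) → Tm n → Tm m
  | _, _, f, _, .fvar x => f x
  | _, _, _, g, .bvar i => g i
  | _, _, _, _, .cst b => .cst b
  | n, m, f, g, .lam M =>
      .lam (M.bind (fun x => (f x).weaken)
        (Fin.cons (.bvar 0) (fun i => (g i).weaken) : Fin (n + 1) → Tm (m + 1)))
  | _, _, f, g, .app M N => .app (M.bind f g) (N.bind f g)
  | _, _, f, g, .ifte M N₀ N₁ => .ifte (M.bind f g) (N₀.bind f g) (N₁.bind f g)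

/-- `M.inst N` is `M[N/x]`, where `x` is the variable bound by the outermost binder around `M`. -/
def Tm.inst {n : ℕ} (M : Tm (n + 1)) (N : Tm n) : Tm n :=
  M.bind Tm.fvar (Fin.cons N Tm.bvar : Fin (n + 1) → Tm n)

/-- `Tm.abs x M` is `λx.M` for the name `x`. -/
def Tm.abs {n : ℕ} (x : ℕ) (M : Tm n) : Tm n :=
  .lam (M.bind (fun y => if y = x then .bvar 0 else .fvar y) (fun i => .bvar i.succ))

/-- `M.merge s x` is `M[x/x₁, …, x/xₖ]` for `s = {x₁, …, xₖ}`. -/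
def Tm.merge {n : ℕ} (M : Tm n) (s : Finset ℕ) (x : ℕ) : Tm n :=
  M.bind (fun y => if y ∈ s then .fvar x else .fvar y) Tm.bvar

/-- `M.apps [V₁, …, Vₘ]` is `M V₁ ⋯ Vₘ`. -/
def Tm.apps {n : ℕ} (M : Tm n) (Vs : List (Tm n)) : Tm n := Vs.foldl Tm.app M

/-! ### Reduction -/

/-- One-step reduction: the contextual closure of the rules `β` and `δ`. -/
inductive Red : {n : ℕ} → Tm n → Tm n → Prop
  | beta {n : ℕ} (M : Tm (n + 1)) (N : Tm n) : Red (.app (.lam M) N) (M.inst N)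
  | ifZero {n : ℕ} (M N : Tm n) : Red (.ifte (.cst .zero) M N) M
  | ifOne {n : ℕ} (M N : Tm n) : Red (.ifte (.cst .one) M N) N
  | lam {n : ℕ} {M M' : Tm (n + 1)} : Red M M' → Red (.lam M) (.lam M')
  | appLeft {n : ℕ} {M M' : Tm n} (N : Tm n) : Red M M' → Red (.app M N) (.app M' N)
  | appRight {n : ℕ} (M : Tm n) {N N' : Tm n} : Red N N' → Red (.app M N) (.app M N')
  | ifTest {n : ℕ} {M M' : Tm n} (N₀ N₁ : Tm n) :
      Red M M' → Red (.ifte M N₀ N₁) (.ifte M' N₀ N₁)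
  | ifThen {n : ℕ} (M : Tm n) {N₀ N₀' : Tm n} (N₁ : Tm n) :
      Red N₀ N₀' → Red (.ifte M N₀ N₁) (.ifte M N₀' N₁)
  | ifElse {n : ℕ} (M N₀ : Tm n) {N₁ N₁' : Tm n} :
      Red N₁ N₁' → Red (.ifte M N₀ N₁) (.ifte M N₀ N₁')

/-- `M →* N` on terms. -/
def RedStar (M N : Term) : Prop := Relation.ReflTransGen Red M N

/-! ### Types, modulo renaming of bound type variables -/

mutual
  /-- Linear types `A ::= B | α | σ ⊸ A | ∀α.A`, below `n` quantifiers; free type variables are names,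
  bound ones are indices. -/
  inductive LTy : ℕ → Type
    | bool {n : ℕ} : LTy n
    | fvar {n : ℕ} (α : ℕ) : LTy n
    | bvar {n : ℕ} (i : Fin n) : LTy n
    | arr {n : ℕ} (σ : Ty n) (A : LTy n) : LTy n
    | all {n : ℕ} (A : LTy (n + 1)) : LTy n
  /-- Types `σ ::= A | !σ`. -/
  inductive Ty : ℕ → Type
    | lin {n : ℕ} (A : LTy n) : Ty n
    | bang {n : ℕ} (σ : Ty n) : Ty n
end

mutual
  /-- Free type variables of a linear type. -/
  def LTy.FTV : {n : ℕ} → LTy n → Finset ℕ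
    | _, .bool => ∅
    | _, .fvar α => {α}
    | _, .bvar _ => ∅
    | _, .arr σ A => σ.FTV ∪ A.FTV
    | _, .all A => A.FTV
  /-- Free type variables of a type. -/
  def Ty.FTV : {n : ℕ} → Ty n → Finset ℕ
    | _, .lin A => A.FTV
    | _, .bang σ => σ.FTV
end

mutual
  /-- Renaming of the bound type variables. -/
  def LTy.rename : {n m : ℕ} → (Fin n → Fin m) → LTy n → LTy m
    | _, _, _, .bool => .bool
    | _, _, _, .fvar α => .fvar α
    | _, _, ρ, .bvar i => .bvar (ρ i)
    | _, _, ρ, .arr σ A => .arr (σ.rename ρ) (A.rename ρ)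
    | n, m, ρ, .all A =>
        .all (A.rename (Fin.cons 0 (fun i => (ρ i).succ) : Fin (n + 1) → Fin (m + 1)))
  /-- Renaming of the bound type variables. -/
  def Ty.rename : {n m : ℕ} → (Fin n → Fin m) → Ty n → Ty m
    | _, _, ρ, .lin A => .lin (A.rename ρ)
    | _, _, ρ, .bang σ => .bang (σ.rename ρ)
end

/-- The same linear type, placed below one more quantifier. -/
def LTy.weaken {n : ℕ} (A : LTy n) : LTy (n + 1) := A.rename Fin.succ

mutual
  /-- Simultaneous capture-free substitution of linear types for type variables. -/
  def LTy.bind : {n m : ℕ} → (ℕ → LTy m) → (Fin n → LTy m) → LTy n → LTy m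
    | _, _, _, _, .bool => .bool
    | _, _, f, _, .fvar α => f α
    | _, _, _, g, .bvar i => g i
    | _, _, f, g, .arr σ A => .arr (σ.bind f g) (A.bind f g)
    | n, m, f, g, .all A =>
        .all (A.bind (fun α => (f α).weaken)
          (Fin.cons (.bvar 0) (fun i => (g i).weaken) : Fin (n + 1) → LTy (m + 1)))
  /-- Simultaneous capture-free substitution of linear types for type variables. -/
  def Ty.bind : {n m : ℕ} → (ℕ → LTy m) → (Fin n → LTy m) → Ty n → Ty m
    | _, _, f, g, .lin A => .lin (A.bind f g)
    | _, _, f, g, .bang σ => .bang (σ.bind f g)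
end

/-- `B.inst A` is `B[A/α]`, where `α` is the variable bound by the outermost quantifier around `B`. -/
def LTy.inst {n : ℕ} (B : LTy (n + 1)) (A : LTy n) : LTy n :=
  B.bind LTy.fvar (Fin.cons A LTy.bvar : Fin (n + 1) → LTy n)

/-- `LTy.gen α A` is `∀α.A` for the name `α`. -/
def LTy.gen {n : ℕ} (α : ℕ) (A : LTy n) : LTy n :=
  .all (A.bind (fun β => if β = α then .bvar 0 else .fvar β) (fun i => .bvar i.succ))

/-! ### The type assignment system -/

/-- A context assigns types to some of the variables, at most one type to each. -/
def Ctx : Type := ℕ → Option (Ty 0)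

/-- The empty context. -/
def Ctx.empty : Ctx := fun _ => none

/-- `Γ, x:σ` (used for `x ∉ dom Γ`). -/
def Ctx.extend (Γ : Ctx) (x : ℕ) (σ : Ty 0) : Ctx := fun y => if y = x then some σ else Γ y

/-- `Γ, x₁:σ, …, xₖ:σ` for `s = {x₁, …, xₖ}` (used for `s` disjoint from `dom Γ`). -/
def Ctx.extendSet (Γ : Ctx) (s : Finset ℕ) (σ : Ty 0) : Ctx :=
  fun y => if y ∈ s then some σ else Γ y

/-- `Γ # Δ`: the domains are disjoint. -/
def Ctx.Disj (Γ Δ : Ctx) : Prop := ∀ x, Γ x = none ∨ Δ x = none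

/-- `Γ, Δ` (used for `Γ # Δ`). -/
def Ctx.union (Γ Δ : Ctx) : Ctx := fun x => (Γ x).or (Δ x)

/-- `!Γ`. -/
def Ctx.bang (Γ : Ctx) : Ctx := fun x => (Γ x).map Ty.bang

/-- `α ∈ FTV(Γ)`. -/
def Ctx.MemFTV (α : ℕ) (Γ : Ctx) : Prop := ∃ x σ, Γ x = some σ ∧ α ∈ σ.FTV

/-- The judgement `Γ ⊢ M : σ`. -/
inductive Typing : Ctx → Term → Ty 0 → Prop
  | ax (x : ℕ) (A : LTy 0) : Typing (Ctx.empty.extend x (.lin A)) (.fvar x) (.lin A)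
  | boolI (b : BConst) : Typing Ctx.empty (.cst b) (.lin .bool)
  | w {Γ : Ctx} {M : Term} {σ : Ty 0} (x : ℕ) (A : LTy 0) :
      Γ x = none → Typing Γ M σ → Typing (Γ.extend x (.lin A)) M σ
  | arrI {Γ : Ctx} {x : ℕ} {M : Term} {σ : Ty 0} {A : LTy 0} :
      Γ x = none → Typing (Γ.extend x σ) M (.lin A) → Typing Γ (Tm.abs x M) (.lin (.arr σ A))
  | arrE {Γ Δ : Ctx} {M N : Term} {σ : Ty 0} {A : LTy 0} :
      Typing Γ M (.lin (.arr σ A)) → Typing Δ N σ → Γ.Disj Δ →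
      Typing (Γ.union Δ) (.app M N) (.lin A)
  | m {Γ : Ctx} {M : Term} {σ τ : Ty 0} (s : Finset ℕ) (x : ℕ) :
      (∀ y ∈ s, Γ y = none) → Γ x = none → Typing (Γ.extendSet s σ) M τ →
      Typing (Γ.extend x σ.bang) (M.merge s x) τ
  | sp {Γ : Ctx} {M : Term} {σ : Ty 0} : Typing Γ M σ → Typing Γ.bang M σ.bang
  | allE {Γ : Ctx} {M : Term} {B : LTy 1} (A : LTy 0) :
      Typing Γ M (.lin (.all B)) → Typing Γ M (.lin (B.inst A))
  | allI {Γ : Ctx} {M : Term} {A : LTy 0} (α : ℕ) :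
      Typing Γ M (.lin A) → ¬ Ctx.MemFTV α Γ → Typing Γ M (.lin (LTy.gen α A))
  | boolE {Γ : Ctx} {M N₀ N₁ : Term} {A : LTy 0} :
      Typing Γ M (.lin .bool) → Typing Γ N₀ (.lin A) → Typing Γ N₁ (.lin A) →
      Typing Γ (.ifte M N₀ N₁) (.lin A)

/-- Programs: the terms `M` with `⊢ M : B`. -/
def IsProgram (M : Term) : Prop := Typing Ctx.empty M (.lin .bool)

/-! ### The evaluation machine -/

/-- m-contexts: sequences of assignments `x := M` to distinct variables. -/
structure MCtx : Type where
  assigns : List (ℕ × Term)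
  nodup : (assigns.map Prod.fst).Nodup

/-- The empty m-context. -/
def MCtx.empty : MCtx := ⟨[], List.nodup_nil⟩

/-- The variables that are assigned a term. -/
def MCtx.dom (𝒜 : MCtx) : List ℕ := 𝒜.assigns.map Prod.fst

/-- `𝒜 @ {x := N}`. -/
def MCtx.snoc (𝒜 : MCtx) (x : ℕ) (N : Term) (hx : x ∉ 𝒜.dom) : MCtx where
  assigns := 𝒜.assigns ++ [(x, N)]
  nodup := by
    have h := 𝒜.nodup
    unfold MCtx.dom at hx
    simp only [List.map_append, List.map_cons, List.map_nil]
    rw [List.nodup_append]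
    refine ⟨h, List.nodup_singleton _, ?_⟩
    intro a ha b hb hab
    rw [List.mem_singleton] at hb
    exact hx (hb ▸ hab ▸ ha)

/-- B-contexts: `∘` and `(if 𝒞 then M else N) V₁ ⋯ Vₙ`. -/
inductive BCtx : Type
  | hole : BCtx
  | ifte (𝒞 : BCtx) (M N : Term) (Vs : List Term) : BCtx

/-- `𝒞.comp 𝒟` is `𝒞[𝒟[∘]]`. -/
def BCtx.comp : BCtx → BCtx → BCtx
  | .hole, 𝒟 => 𝒟
  | .ifte 𝒞 M N Vs, 𝒟 => .ifte (𝒞.comp 𝒟) M N Vs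

/-- `x ∈ FV(𝒞)`. -/
def BCtx.MemFV (x : ℕ) : BCtx → Prop
  | .hole => False
  | .ifte 𝒞 M N Vs => 𝒞.MemFV x ∨ x ∈ M.FV ∨ x ∈ N.FV ∨ ∃ V ∈ Vs, x ∈ V.FV

/-- `x` occurs nowhere in the configuration with contexts `𝒞`, `𝒜` and subject `M`. -/
structure Fresh (x : ℕ) (𝒞 : BCtx) (𝒜 : MCtx) (M : Term) : Prop where
  dom : x ∉ 𝒜.dom
  mctx : ∀ p ∈ 𝒜.assigns, x ∉ p.2.FV
  bctx : ¬ 𝒞.MemFV x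
  subject : x ∉ M.FV

/-- `Eval 𝒞 𝒜 M b` is the statement `𝒞, 𝒜 ⊨ M ⇓ b`. -/
inductive Eval : BCtx → MCtx → Term → BConst → Prop
  | ax (𝒞 : BCtx) (𝒜 : MCtx) (b : BConst) : Eval 𝒞 𝒜 (.cst b) b
  | beta {𝒞 : BCtx} {𝒜 : MCtx} {M : Tm 1} {N : Term} {Vs : List Term} {b : BConst} {x : ℕ}
      (hx : Fresh x 𝒞 𝒜 ((Tm.app (.lam M) N).apps Vs)) :
      Eval 𝒞 (𝒜.snoc x N hx.dom) ((M.inst (.fvar x)).apps Vs) b →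
      Eval 𝒞 𝒜 ((Tm.app (.lam M) N).apps Vs) b
  | head {𝒞 : BCtx} {𝒜 : MCtx} {x : ℕ} {N : Term} {Vs : List Term} {b : BConst} :
      (x, N) ∈ 𝒜.assigns → Eval 𝒞 𝒜 (N.apps Vs) b → Eval 𝒞 𝒜 ((Tm.fvar x).apps Vs) b
  | ifZero {𝒞 : BCtx} {𝒜 : MCtx} {M N₀ N₁ : Term} {Vs : List Term} {b : BConst} :
      Eval (𝒞.comp (.ifte .hole N₀ N₁ Vs)) 𝒜 M .zero → Eval 𝒞 𝒜 (N₀.apps Vs) b →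
      Eval 𝒞 𝒜 ((Tm.ifte M N₀ N₁).apps Vs) b
  | ifOne {𝒞 : BCtx} {𝒜 : MCtx} {M N₀ N₁ : Term} {Vs : List Term} {b : BConst} :
      Eval (𝒞.comp (.ifte .hole N₀ N₁ Vs)) 𝒜 M .one → Eval 𝒞 𝒜 (N₁.apps Vs) b →
      Eval 𝒞 𝒜 ((Tm.ifte M N₀ N₁).apps Vs) b

/-- `⊨ M ⇓ b`. -/
def Evaluates (M : Term) (b : BConst) : Prop := Eval .hole .empty M b

end STAB

-- A machine configuration represents the term obtained by substituting the assignments of its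
-- m-context away. Freshness keeps the m-context acyclic, so this unfolding is well defined, and all
-- arguments take place on unfolded terms; the B-context only constrains which variables are fresh.
--
-- Soundness (`Eval.redStar`) is an induction on the evaluation: a machine β-step unfolds to a
-- β-step, a variable lookup does not change the unfolded term, and a conditional unfolds to the
-- reduction of its test followed by a δ-step.
--
-- Completeness needs a strategy. By standardization (`Std.tail`), any reduction to a boolean can be
-- replaced by weak head reduction (`RedStar.whRedStar_cst`). Such a reduction is turned into the
-- big-step derivation `StackEval`, which still substitutes but has the shape of the machine rules.
-- `StackEval.eval` simulates it from every configuration that unfolds to the given term and stack;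
-- the only additional moves are lookups, and chains of these end by acyclicity
-- (`Unfolding.exists_resolved`).

namespace STAB

/-! ### Substitution -/

namespace Tm

/-- The index substitution used below a binder. -/
def lift {n m : ℕ} (g : Fin n → Tm m) : Fin (n + 1) → Tm (m + 1) :=
  Fin.cons (.bvar 0) (fun i => (g i).weaken)

theorem bind_lam {n m : ℕ} (f : ℕ → Tm m) (g : Fin n → Tm m) (M : Tm (n + 1)) :
    (lam M).bind f g = lam (M.bind (fun x => (f x).weaken) (lift g)) := rfl

theorem rename_eq_bind {n m : ℕ} (ρ : Fin n → Fin m) (M : Tm n) :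
    M.rename ρ = M.bind fvar (fun i => bvar (ρ i)) := by
  induction M generalizing m with
  | fvar x => rfl
  | bvar i => rfl
  | cst b => rfl
  | lam M ih =>
    rw [bind_lam, rename, ih]
    congr 2
    funext i
    refine Fin.cases ?_ (fun j => ?_) i <;> simp [lift, weaken, rename]
  | app M N ihM ihN => simp [rename, bind, ihM, ihN]
  | ifte M N P ihM ihN ihP => simp [rename, bind, ihM, ihN, ihP]

theorem bind_rename {n m k : ℕ} (ρ : Fin n → Fin m) (f : ℕ → Tm k) (g : Fin m → Tm k) (M : Tm n) :
    (M.rename ρ).bind f g = M.bind f (fun i => g (ρ i)) := by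
  induction M generalizing m k with
  | fvar x => rfl
  | bvar i => rfl
  | cst b => rfl
  | lam M ih =>
    rw [rename, bind_lam, bind_lam, ih]
    congr 2
    funext i
    refine Fin.cases ?_ (fun j => ?_) i <;> simp [lift]
  | app M N ihM ihN => simp [rename, bind, ihM, ihN]
  | ifte M N P ihM ihN ihP => simp [rename, bind, ihM, ihN, ihP]

theorem rename_rename {n m k : ℕ} (ρ : Fin n → Fin m) (θ : Fin m → Fin k) (M : Tm n) :
    (M.rename ρ).rename θ = M.rename (fun i => θ (ρ i)) := by
  rw [rename_eq_bind θ, bind_rename, rename_eq_bind]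

theorem rename_bind {n m k : ℕ} (f : ℕ → Tm m) (g : Fin n → Tm m) (ρ : Fin m → Fin k) (M : Tm n) :
    (M.bind f g).rename ρ = M.bind (fun x => (f x).rename ρ) (fun i => (g i).rename ρ) := by
  induction M generalizing m k with
  | fvar x => rfl
  | bvar i => rfl
  | cst b => rfl
  | lam M ih =>
    rw [bind_lam, rename, bind_lam, ih]
    congr 2
    · funext x
      simp [weaken, rename_rename]
    · funext i
      refine Fin.cases ?_ (fun j => ?_) i <;> simp [lift, weaken, rename_rename, rename]
  | app M N ihM ihN => simp [rename, bind, ihM, ihN]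
  | ifte M N P ihM ihN ihP => simp [rename, bind, ihM, ihN, ihP]

/-- This is what the binder case of `bind_bind` needs. It follows from the two mixed laws for
`rename` and `bind`, which therefore come before composition of substitutions. -/
theorem weaken_bind {n m : ℕ} (f : ℕ → Tm m) (g : Fin n → Tm m) (M : Tm n) :
    M.weaken.bind (fun x => (f x).weaken) (lift g) = (M.bind f g).weaken := by
  rw [weaken, weaken, bind_rename, rename_bind]
  rfl

theorem bind_bind {n m k : ℕ} (f : ℕ → Tm m) (g : Fin n → Tm m) (f' : ℕ → Tm k) (g' : Fin m → Tm k)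
    (M : Tm n) :
    (M.bind f g).bind f' g' = M.bind (fun x => (f x).bind f' g') (fun i => (g i).bind f' g') := by
  induction M generalizing m k with
  | fvar x => rfl
  | bvar i => rfl
  | cst b => rfl
  | lam M ih =>
    rw [bind_lam, bind_lam, bind_lam, ih]
    congr 2
    · funext x
      rw [weaken_bind]
    · funext i
      refine Fin.cases ?_ (fun j => ?_) i
      · simp [lift, bind]
      · simpa [lift] using weaken_bind f' g' (g j)
  | app M N ihM ihN => simp [bind, ihM, ihN]
  | ifte M N P ihM ihN ihP => simp [bind, ihM, ihN, ihP]

theorem lift_bvar {n : ℕ} : lift (bvar : Fin n → Tm n) = bvar := by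
  funext i
  refine Fin.cases ?_ (fun j => ?_) i <;> simp [lift, weaken, rename]

theorem bind_fvar_bvar {n : ℕ} (M : Tm n) : M.bind fvar bvar = M := by
  induction M with
  | fvar x => rfl
  | bvar i => rfl
  | cst b => rfl
  | lam M ih =>
    rw [bind_lam, lift_bvar]
    exact congrArg lam ih
  | app M N ihM ihN => simp [bind, ihM, ihN]
  | ifte M N P ihM ihN ihP => simp [bind, ihM, ihN, ihP]

theorem bind_congr {n m : ℕ} {f f' : ℕ → Tm m} (g : Fin n → Tm m) {M : Tm n}
    (h : ∀ x ∈ M.FV, f x = f' x) : M.bind f g = M.bind f' g := by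
  induction M generalizing m with
  | fvar x => exact h x (by simp [FV])
  | bvar i => rfl
  | cst b => rfl
  | lam M ih =>
    rw [bind_lam, bind_lam, ih _ (fun x hx => by rw [h x hx])]
  | app M N ihM ihN =>
    simp only [bind]
    rw [ihM g fun x hx => h x (by simp [FV, hx]), ihN g fun x hx => h x (by simp [FV, hx])]
  | ifte M N P ihM ihN ihP =>
    simp only [bind]
    rw [ihM g fun x hx => h x (by simp [FV, hx]), ihN g fun x hx => h x (by simp [FV, hx]),
      ihP g fun x hx => h x (by simp [FV, hx])]

theorem weaken_inst {n : ℕ} (M N : Tm n) : M.weaken.inst N = M := by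
  rw [weaken, inst, bind_rename]
  exact bind_fvar_bvar M

/-- Together with `inst_bind` this is the substitution lemma: both orders of substituting and
contracting a β-redex equal one simultaneous substitution. -/
theorem bind_lift_inst {n m : ℕ} (f : ℕ → Tm m) (g : Fin n → Tm m) (M : Tm (n + 1)) (N : Tm m) :
    (M.bind (fun x => (f x).weaken) (lift g)).inst N = M.bind f (Fin.cons N g) := by
  rw [inst, bind_bind]
  congr 1
  · funext x
    exact weaken_inst (f x) N
  · funext i
    refine Fin.cases ?_ (fun j => ?_) i
    · simp [lift, bind]
    · simpa [lift, inst] using weaken_inst (g j) N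

theorem inst_bind {n m : ℕ} (f : ℕ → Tm m) (g : Fin n → Tm m) (M : Tm (n + 1)) (N : Tm n) :
    (M.inst N).bind f g = M.bind f (Fin.cons (N.bind f g) g) := by
  rw [inst, bind_bind]
  congr 1
  funext i
  refine Fin.cases ?_ (fun j => ?_) i <;> simp [bind]

theorem apps_bind {n m : ℕ} (f : ℕ → Tm m) (g : Fin n → Tm m) (M : Tm n) (Vs : List (Tm n)) :
    (M.apps Vs).bind f g = (M.bind f g).apps (Vs.map fun V => V.bind f g) := by
  induction Vs generalizing M with
  | nil => rfl
  | cons V Vs ih => exact ih (app M V)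

theorem mem_FV_apps {n : ℕ} {x : ℕ} {M : Tm n} {Vs : List (Tm n)} :
    x ∈ (M.apps Vs).FV ↔ x ∈ M.FV ∨ ∃ V ∈ Vs, x ∈ V.FV := by
  induction Vs generalizing M with
  | nil => simp [apps]
  | cons V Vs ih =>
    change x ∈ ((app M V).apps Vs).FV ↔ _
    rw [ih]
    simp [FV, or_assoc]

end Tm

/-! ### Weak head reduction and standardization -/

/-- One step of weak head reduction. -/
inductive WHRed : {n : ℕ} → Tm n → Tm n → Prop
  | beta {n : ℕ} (M : Tm (n + 1)) (N : Tm n) : WHRed (.app (.lam M) N) (M.inst N)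
  | ifZero {n : ℕ} (M N : Tm n) : WHRed (.ifte (.cst .zero) M N) M
  | ifOne {n : ℕ} (M N : Tm n) : WHRed (.ifte (.cst .one) M N) N
  | appLeft {n : ℕ} {M M' : Tm n} (N : Tm n) : WHRed M M' → WHRed (.app M N) (.app M' N)
  | ifTest {n : ℕ} {M M' : Tm n} (N₀ N₁ : Tm n) :
      WHRed M M' → WHRed (.ifte M N₀ N₁) (.ifte M' N₀ N₁)

/-- Many steps of weak head reduction. -/
def WHRedStar {n : ℕ} : Tm n → Tm n → Prop := Relation.ReflTransGen WHRed

theorem WHRed.bind {n m : ℕ} {M M' : Tm n} (h : WHRed M M') (f : ℕ → Tm m) (g : Fin n → Tm m) :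
    WHRed (M.bind f g) (M'.bind f g) := by
  induction h with
  | beta M N =>
    rw [Tm.inst_bind, ← Tm.bind_lift_inst]
    exact .beta _ _
  | ifZero M N => exact .ifZero _ _
  | ifOne M N => exact .ifOne _ _
  | appLeft N _ ih => exact .appLeft _ ih
  | ifTest N₀ N₁ _ ih => exact .ifTest _ _ ih

namespace WHRedStar

theorem bind {n m : ℕ} {M M' : Tm n} (h : WHRedStar M M') (f : ℕ → Tm m) (g : Fin n → Tm m) :
    WHRedStar (M.bind f g) (M'.bind f g) :=
  Relation.ReflTransGen.lift (r := WHRed) (p := WHRed) (fun M => M.bind f g)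
    (fun _ _ h => h.bind f g) _ _ h

theorem rename {n m : ℕ} {M M' : Tm n} (h : WHRedStar M M') (ρ : Fin n → Fin m) :
    WHRedStar (M.rename ρ) (M'.rename ρ) := by
  simpa only [Tm.rename_eq_bind] using h.bind _ _

theorem appLeft {n : ℕ} {M M' : Tm n} (h : WHRedStar M M') (N : Tm n) :
    WHRedStar (.app M N) (.app M' N) :=
  Relation.ReflTransGen.lift (r := WHRed) (p := WHRed) (fun M => Tm.app M N)
    (fun _ _ h => .appLeft N h) _ _ h

theorem ifTest {n : ℕ} {M M' : Tm n} (h : WHRedStar M M') (N₀ N₁ : Tm n) :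
    WHRedStar (.ifte M N₀ N₁) (.ifte M' N₀ N₁) :=
  Relation.ReflTransGen.lift (r := WHRed) (p := WHRed) (fun M => Tm.ifte M N₀ N₁)
    (fun _ _ h => .ifTest N₀ N₁ h) _ _ h

end WHRedStar

/-- `Std M N`: there is a standard reduction from `M` to `N`, that is, weak head steps followed by
standard reductions of the immediate subterms. -/
inductive Std : {n : ℕ} → Tm n → Tm n → Prop
  | fvar {n : ℕ} {M : Tm n} {x : ℕ} : WHRedStar M (.fvar x) → Std M (.fvar x)
  | bvar {n : ℕ} {M : Tm n} {i : Fin n} : WHRedStar M (.bvar i) → Std M (.bvar i)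
  | cst {n : ℕ} {M : Tm n} {b : BConst} : WHRedStar M (.cst b) → Std M (.cst b)
  | lam {n : ℕ} {M : Tm n} {P P' : Tm (n + 1)} :
      WHRedStar M (.lam P) → Std P P' → Std M (.lam P')
  | app {n : ℕ} {M P P' Q Q' : Tm n} :
      WHRedStar M (.app P Q) → Std P P' → Std Q Q' → Std M (.app P' Q')
  | ifte {n : ℕ} {M P P' Q Q' R R' : Tm n} :
      WHRedStar M (.ifte P Q R) → Std P P' → Std Q Q' → Std R R' → Std M (.ifte P' Q' R')

namespace Std

theorem refl {n : ℕ} (M : Tm n) : Std M M := by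
  induction M with
  | fvar x => exact .fvar .refl
  | bvar i => exact .bvar .refl
  | cst b => exact .cst .refl
  | lam M ih => exact .lam .refl ih
  | app M N ihM ihN => exact .app .refl ihM ihN
  | ifte M N P ihM ihN ihP => exact .ifte .refl ihM ihN ihP

theorem head {n : ℕ} {M N P : Tm n} (h : WHRedStar M N) (hs : Std N P) : Std M P := by
  cases hs with
  | fvar h' => exact .fvar (h.trans h')
  | bvar h' => exact .bvar (h.trans h')
  | cst h' => exact .cst (h.trans h')
  | lam h' h₁ => exact .lam (h.trans h') h₁
  | app h' h₁ h₂ => exact .app (h.trans h') h₁ h₂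
  | ifte h' h₁ h₂ h₃ => exact .ifte (h.trans h') h₁ h₂ h₃

theorem rename {n m : ℕ} {M N : Tm n} (h : Std M N) (ρ : Fin n → Fin m) :
    Std (M.rename ρ) (N.rename ρ) := by
  induction h generalizing m with
  | fvar h => exact .fvar (h.rename ρ)
  | bvar h => exact .bvar (h.rename ρ)
  | cst h => exact .cst (h.rename ρ)
  | lam h _ ih => exact .lam (h.rename ρ) (ih _)
  | app h _ _ ih₁ ih₂ => exact .app (h.rename ρ) (ih₁ ρ) (ih₂ ρ)
  | ifte h _ _ _ ih₁ ih₂ ih₃ => exact .ifte (h.rename ρ) (ih₁ ρ) (ih₂ ρ) (ih₃ ρ)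

/-- Weak head steps survive substitution; when they end in a variable, the standard reduction of the
term substituted for it is appended. -/
theorem bind {n m : ℕ} {M N : Tm n} (h : Std M N) {f f' : ℕ → Tm m} {g g' : Fin n → Tm m}
    (hf : ∀ x, Std (f x) (f' x)) (hg : ∀ i, Std (g i) (g' i)) :
    Std (M.bind f g) (N.bind f' g') := by
  induction h generalizing m with
  | fvar h => exact head (h.bind f g) (hf _)
  | bvar h => exact head (h.bind f g) (hg _)
  | cst h => exact .cst (h.bind f g)
  | lam h _ ih =>
    refine .lam (h.bind f g) (ih (fun x => (hf x).rename _) fun i => ?_)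
    refine Fin.cases (refl _) (fun j => ?_) i
    exact (hg j).rename _
  | app h _ _ ih₁ ih₂ => exact .app (h.bind f g) (ih₁ hf hg) (ih₂ hf hg)
  | ifte h _ _ _ ih₁ ih₂ ih₃ =>
    exact .ifte (h.bind f g) (ih₁ hf hg) (ih₂ hf hg) (ih₃ hf hg)

theorem inst {n : ℕ} {M M' : Tm (n + 1)} {N N' : Tm n} (hM : Std M M') (hN : Std N N') :
    Std (M.inst N) (M'.inst N') :=
  hM.bind (fun _ => refl _) (Fin.cases hN fun _ => refl _)

/-- The core of standardization. If the contracted redex is at the root, its λ or boolean is already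
reached by weak head steps, so the contraction can be moved forward among them. Otherwise the step
lies in an immediate subterm and is absorbed there. -/
theorem tail {n : ℕ} {M N P : Tm n} (h : Std M N) (hr : Red N P) : Std M P := by
  induction hr with
  | beta A B =>
    cases h with
    | app h h₁ h₂ =>
      cases h₁ with
      | lam h' h₃ => exact head ((h.trans (h'.appLeft _)).tail (.beta _ _)) (h₃.inst h₂)
  | ifZero A B =>
    cases h with
    | ifte h h₁ h₂ h₃ =>
      cases h₁ with
      | cst h' => exact head ((h.trans (h'.ifTest _ _)).tail (.ifZero _ _)) h₂
  | ifOne A B =>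
    cases h with
    | ifte h h₁ h₂ h₃ =>
      cases h₁ with
      | cst h' => exact head ((h.trans (h'.ifTest _ _)).tail (.ifOne _ _)) h₃
  | lam _ ih => cases h with | lam h h₁ => exact .lam h (ih h₁)
  | appLeft _ _ ih => cases h with | app h h₁ h₂ => exact .app h (ih h₁) h₂
  | appRight _ _ ih => cases h with | app h h₁ h₂ => exact .app h h₁ (ih h₂)
  | ifTest _ _ _ ih => cases h with | ifte h h₁ h₂ h₃ => exact .ifte h (ih h₁) h₂ h₃
  | ifThen _ _ _ ih => cases h with | ifte h h₁ h₂ h₃ => exact .ifte h h₁ (ih h₂) h₃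
  | ifElse _ _ _ ih => cases h with | ifte h h₁ h₂ h₃ => exact .ifte h h₁ h₂ (ih h₃)

end Std

theorem RedStar.std {M N : Term} (h : RedStar M N) : Std M N := by
  induction h with
  | refl => exact .refl M
  | tail _ h ih => exact ih.tail h

/-- A boolean has no subterms, so a standard reduction to it consists of weak head steps alone. -/
theorem RedStar.whRedStar_cst {M : Term} {b : BConst} (h : RedStar M (.cst b)) :
    WHRedStar M (.cst b) := by
  cases h.std with
  | cst h => exact h

/-! ### Evaluation with an argument stack -/

/-- `StackEval M Vs b`: the term `M V₁ ⋯ Vₙ` evaluates to `b` by weak head reduction, with the arguments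
kept on a stack. -/
inductive StackEval : Term → List Term → BConst → Prop
  | cst (b : BConst) : StackEval (.cst b) [] b
  | app {M N : Term} {Vs : List Term} {b : BConst} :
      StackEval M (N :: Vs) b → StackEval (.app M N) Vs b
  | lam {M : Tm 1} {N : Term} {Vs : List Term} {b : BConst} :
      StackEval (M.inst N) Vs b → StackEval (.lam M) (N :: Vs) b
  | ifZero {M N₀ N₁ : Term} {Vs : List Term} {b : BConst} :
      StackEval M [] .zero → StackEval N₀ Vs b → StackEval (.ifte M N₀ N₁) Vs b
  | ifOne {M N₀ N₁ : Term} {Vs : List Term} {b : BConst} :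
      StackEval M [] .one → StackEval N₁ Vs b → StackEval (.ifte M N₀ N₁) Vs b

/-- The index `n` with `hn` and the casts only serve to allow induction on `WHRed`, an indexed
family. The stack must vary, since a step in function position is taken with one more argument on
it. -/
theorem StackEval.head_expansion {n : ℕ} {M M' : Tm n} (h : WHRed M M') (hn : n = 0)
    {Vs : List Term} {b : BConst} (hs : StackEval (cast (congrArg Tm hn) M') Vs b) :
    StackEval (cast (congrArg Tm hn) M) Vs b := by
  induction h generalizing Vs b with
  | beta M N => subst hn; exact .app (.lam hs)
  | ifZero M N => subst hn; exact .ifZero (.cst _) hs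
  | ifOne M N => subst hn; exact .ifOne (.cst _) hs
  | appLeft N _ ih =>
    subst hn
    cases hs with
    | app h => exact .app (ih h)
  | ifTest N₀ N₁ _ ih =>
    subst hn
    cases hs with
    | ifZero h h' => exact .ifZero (ih h) h'
    | ifOne h h' => exact .ifOne (ih h) h'

theorem StackEval.of_whRedStar {M : Term} {b : BConst} (h : WHRedStar M (.cst b)) :
    StackEval M [] b := by
  induction h using Relation.ReflTransGen.head_induction_on with
  | refl => exact .cst b
  | head h _ ih => exact ih.head_expansion h rfl

/-! ### Unfolding m-contexts -/

/-- `f` maps each variable to the term that it stands for in the m-context `𝒜`, and the rank `r`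
witnesses that `𝒜` is acyclic. -/
structure Unfolding (𝒜 : MCtx) (f : ℕ → Term) (r : ℕ → ℕ) : Prop where
  assigned : ∀ x N, (x, N) ∈ 𝒜.assigns → f x = N.bind f Tm.bvar
  unassigned : ∀ x, x ∉ 𝒜.dom → f x = .fvar x
  rank_lt : ∀ x N, (x, N) ∈ 𝒜.assigns → ∀ y ∈ N.FV, r y < r x

theorem Unfolding.empty : Unfolding .empty Tm.fvar (fun _ => 0) where
  assigned _ _ h := by cases h
  unassigned _ _ := rfl
  rank_lt _ _ h := by cases h

/-- Since `x` occurs neither in `N` nor in the older assigned terms, changing `f` and `r` at `x`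
disturbs nothing. The new rank exceeds that of every variable of `N`. -/
theorem Unfolding.snoc {𝒜 : MCtx} {f : ℕ → Term} {r : ℕ → ℕ} (h : Unfolding 𝒜 f r) {x : ℕ} {N : Term}
    (hx : x ∉ 𝒜.dom) (hA : ∀ p ∈ 𝒜.assigns, x ∉ p.2.FV) (hN : x ∉ N.FV) :
    Unfolding (𝒜.snoc x N hx) (Function.update f x (N.bind f Tm.bvar))
      (Function.update r x (N.FV.sup r + 1)) := by
  have key : ∀ P : Term, x ∉ P.FV →
      P.bind (Function.update f x (N.bind f Tm.bvar)) Tm.bvar = P.bind f Tm.bvar := fun P hP =>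
    Tm.bind_congr _ fun y hy => Function.update_of_ne (ne_of_mem_of_not_mem hy hP) _ _
  have ne : ∀ y P, (y, P) ∈ 𝒜.assigns → y ≠ x := fun y P hy e =>
    hx (e ▸ List.mem_map_of_mem (f := Prod.fst) hy)
  constructor
  · intro y P hy
    simp only [MCtx.snoc, List.mem_append, List.mem_singleton, Prod.mk.injEq] at hy
    rcases hy with hy | ⟨rfl, rfl⟩
    · rw [Function.update_of_ne (ne y P hy), key P (hA _ hy), h.assigned y P hy]
    · rw [Function.update_self, key P hN]
  · intro y hy
    simp only [MCtx.dom, MCtx.snoc, List.map_append, List.mem_append, not_or] at hy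
    rw [Function.update_of_ne (by simpa using hy.2), h.unassigned y hy.1]
  · intro y P hy z hz
    simp only [MCtx.snoc, List.mem_append, List.mem_singleton, Prod.mk.injEq] at hy
    rcases hy with hy | ⟨rfl, rfl⟩
    · rw [Function.update_of_ne (ne y P hy), Function.update_of_ne (ne_of_mem_of_not_mem hz (hA _ hy))]
      exact h.rank_lt y P hy z hz
    · rw [Function.update_self, Function.update_of_ne (ne_of_mem_of_not_mem hz hN)]
      exact Nat.lt_succ_of_le (Finset.le_sup hz)

/-- Unfolding after a machine `β`-step is the same as unfolding and then contracting the redex. -/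
theorem bind_update_of_notMem_FV {f : ℕ → Term} {x : ℕ} {M : Tm 1} {N : Term} {Vs : List Term}
    (hM : x ∉ M.FV) (hVs : ∀ V ∈ Vs, x ∉ V.FV) :
    (M.inst (.fvar x)).bind (Function.update f x (N.bind f Tm.bvar)) Tm.bvar =
        (M.bind (fun y => (f y).weaken) (Tm.lift Tm.bvar)).inst (N.bind f Tm.bvar) ∧
      (Vs.map fun V => V.bind (Function.update f x (N.bind f Tm.bvar)) Tm.bvar) =
        Vs.map fun V => V.bind f Tm.bvar := by
  have ne : ∀ {k : ℕ} {P : Tm k}, x ∉ P.FV → ∀ y ∈ P.FV,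
      Function.update f x (N.bind f Tm.bvar) y = f y := fun hP y hy =>
    Function.update_of_ne (ne_of_mem_of_not_mem hy hP) _ _
  refine ⟨?_, List.map_congr_left fun V hV => Tm.bind_congr _ (ne (hVs V hV))⟩
  rw [Tm.inst_bind, Tm.bind_lift_inst, Tm.bind_congr _ (ne hM)]
  simp [Tm.bind]

/-! ### Soundness -/

theorem Fresh.notMem_FV_redex {x : ℕ} {𝒞 : BCtx} {𝒜 : MCtx} {M : Tm 1} {N : Term} {Vs : List Term}
    (hx : Fresh x 𝒞 𝒜 ((Tm.app (.lam M) N).apps Vs)) :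
    x ∉ M.FV ∧ x ∉ N.FV ∧ ∀ V ∈ Vs, x ∉ V.FV := by
  have h := hx.subject
  rw [Tm.mem_FV_apps] at h
  simpa only [Tm.FV, Finset.mem_union, not_or, not_exists, not_and, and_assoc] using h

theorem RedStar.apps {M M' : Term} (h : RedStar M M') (Vs : List Term) :
    RedStar (M.apps Vs) (M'.apps Vs) := by
  induction Vs generalizing M M' with
  | nil => exact h
  | cons V Vs ih =>
    exact ih (Relation.ReflTransGen.lift (r := Red) (p := Red) (fun M => Tm.app M V)
      (fun _ _ h => .appLeft V h) _ _ h)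

theorem RedStar.ifTest {M M' : Term} (h : RedStar M M') (N₀ N₁ : Term) :
    RedStar (.ifte M N₀ N₁) (.ifte M' N₀ N₁) :=
  Relation.ReflTransGen.lift (r := Red) (p := Red) (fun M => Tm.ifte M N₀ N₁)
    (fun _ _ h => .ifTest N₀ N₁ h) _ _ h

theorem Eval.redStar {𝒞 : BCtx} {𝒜 : MCtx} {M : Term} {b : BConst} (h : Eval 𝒞 𝒜 M b)
    {f : ℕ → Term} {r : ℕ → ℕ} (hf : Unfolding 𝒜 f r) : RedStar (M.bind f Tm.bvar) (.cst b) := by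
  induction h generalizing f r with
  | ax 𝒞 𝒜 b => exact .refl
  | beta hx _ ih =>
    obtain ⟨hM, hN, hVs⟩ := hx.notMem_FV_redex
    obtain ⟨e₁, e₂⟩ := bind_update_of_notMem_FV (f := f) hM hVs
    have := ih (hf.snoc hx.dom hx.mctx hN)
    rw [Tm.apps_bind, e₁, e₂] at this
    rw [Tm.apps_bind]
    exact (RedStar.apps (.single (.beta _ _)) _).trans this
  | head hx _ ih =>
    have := ih hf
    rw [Tm.apps_bind] at this ⊢
    -- A lookup costs no reduction step: `x` and the term assigned to it have the same unfolding.
    rwa [Tm.bind, hf.assigned _ _ hx]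
  | ifZero _ _ ih₁ ih₂ =>
    have h₂ := ih₂ hf
    rw [Tm.apps_bind] at h₂ ⊢
    exact (RedStar.apps (((ih₁ hf).ifTest _ _).tail (.ifZero _ _)) _).trans h₂
  | ifOne _ _ ih₁ ih₂ =>
    have h₂ := ih₂ hf
    rw [Tm.apps_bind] at h₂ ⊢
    exact (RedStar.apps (((ih₁ hf).ifTest _ _).tail (.ifOne _ _)) _).trans h₂

theorem Evaluates.redStar {M : Term} {b : BConst} (h : Evaluates M b) : RedStar M (.cst b) := by
  simpa only [Tm.bind_fvar_bvar] using Eval.redStar h .empty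

/-! ### Completeness -/

theorem BCtx.exists_finset_memFV (𝒞 : BCtx) : ∃ s : Finset ℕ, ∀ x, 𝒞.MemFV x → x ∈ s := by
  induction 𝒞 with
  | hole => exact ⟨∅, fun _ h => h.elim⟩
  | ifte 𝒞 M N Vs ih =>
    obtain ⟨s, hs⟩ := ih
    -- The application spine is a device for collecting the free variables of a whole list in one
    -- finite set.
    refine ⟨s ∪ (M.FV ∪ (N.FV ∪ (Tm.apps M Vs).FV)), fun x hx => ?_⟩
    simp only [Finset.mem_union, Tm.mem_FV_apps]
    rcases hx with h | h | h | h
    · exact .inl (hs x h)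
    · exact .inr (.inl h)
    · exact .inr (.inr (.inl h))
    · exact .inr (.inr (.inr (.inr h)))

theorem exists_fresh (𝒞 : BCtx) (𝒜 : MCtx) (M : Term) : ∃ x, Fresh x 𝒞 𝒜 M := by
  obtain ⟨s, hs⟩ := 𝒞.exists_finset_memFV
  obtain ⟨x, hx⟩ := Infinite.exists_notMem_finset
    (𝒜.dom.toFinset ∪ (M.apps (𝒜.assigns.map Prod.snd)).FV ∪ s)
  simp only [Finset.mem_union, Tm.mem_FV_apps, List.mem_toFinset, not_or] at hx
  obtain ⟨⟨hd, hM, hA⟩, hC⟩ := hx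
  exact ⟨x, hd, fun p hp h => hA ⟨p.2, List.mem_map_of_mem hp, h⟩, fun h => hC (hs x h), hM⟩

/-- Following assignments from `M` leads to a term that is not an assigned variable. -/
theorem Unfolding.exists_resolved {𝒜 : MCtx} {f : ℕ → Term} {r : ℕ → ℕ} (hf : Unfolding 𝒜 f r)
    (𝒞 : BCtx) (b : BConst) (M : Term) :
    ∃ H : Term, (∀ x, H = .fvar x → x ∉ 𝒜.dom) ∧ H.bind f Tm.bvar = M.bind f Tm.bvar ∧
      ∀ Vs, Eval 𝒞 𝒜 (H.apps Vs) b → Eval 𝒞 𝒜 (M.apps Vs) b := by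
  by_cases hM : ∃ x, M = .fvar x ∧ x ∈ 𝒜.dom
  · obtain ⟨x, rfl, hx⟩ := hM
    -- If `x` is assigned a variable `y`, then `y` has smaller rank, so a chain of lookups is
    -- finite.
    induction hr : r x using Nat.strong_induction_on generalizing x with
    | _ k ih =>
      obtain ⟨⟨_, N⟩, hN, rfl⟩ := List.mem_map.mp hx
      by_cases hy : ∃ y, N = .fvar y ∧ y ∈ 𝒜.dom
      · obtain ⟨y, rfl, hy⟩ := hy
        obtain ⟨H, h₁, h₂, h₃⟩ := ih (r y) (hr ▸ hf.rank_lt _ _ hN y (by simp [Tm.FV])) y hy rfl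
        exact ⟨H, h₁, h₂.trans (hf.assigned _ _ hN).symm, fun Vs h => .head hN (h₃ Vs h)⟩
      · exact ⟨N, fun y e hd => hy ⟨y, e, hd⟩, (hf.assigned _ _ hN).symm, fun Vs h => .head hN h⟩
  · exact ⟨M, fun x e hd => hM ⟨x, e, hd⟩, rfl, fun _ h => h⟩

/-- In each case lookups first lead to a head `H` that is not an assigned variable. An unassigned
variable unfolds to itself, whereas `T` is not a variable; hence `H` has the outermost constructor
of `T` and the matching machine rule applies. -/
theorem StackEval.eval {T : Term} {Ts : List Term} {b : BConst} (h : StackEval T Ts b) {𝒞 : BCtx}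
    {𝒜 : MCtx} {f : ℕ → Term} {r : ℕ → ℕ} (hf : Unfolding 𝒜 f r) {M : Term} {Vs : List Term}
    (hM : M.bind f Tm.bvar = T) (hVs : Vs.map (fun V => V.bind f Tm.bvar) = Ts) :
    Eval 𝒞 𝒜 (M.apps Vs) b := by
  induction h generalizing 𝒞 𝒜 f r M Vs with
  | cst b =>
    obtain ⟨H, hH, hb, hE⟩ := hf.exists_resolved 𝒞 b M
    refine hE Vs ?_
    rw [List.map_eq_nil_iff.mp hVs]
    cases H with
    | bvar i => exact i.elim0
    | fvar x => simp [Tm.bind, hf.unassigned x (hH x rfl), hM] at hb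
    | cst c =>
      cases hb.trans hM
      exact .ax _ _ _
    | lam P => cases hb.trans hM
    | app P Q => cases hb.trans hM
    | ifte P Q R => cases hb.trans hM
  | @app T U Ts b _ ih =>
    obtain ⟨H, hH, hb, hE⟩ := hf.exists_resolved 𝒞 b M
    refine hE Vs ?_
    cases H with
    | bvar i => exact i.elim0
    | fvar x => simp [Tm.bind, hf.unassigned x (hH x rfl), hM] at hb
    | cst c => cases hb.trans hM
    | lam P => cases hb.trans hM
    | app P Q =>
      cases hb.trans hM
      -- Pushing an argument is not a machine move: both sides denote the same application spine.
      exact ih hf (M := P) (Vs := Q :: Vs) rfl (by simp [hVs])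
    | ifte P Q R => cases hb.trans hM
  | @lam T U Ts b _ ih =>
    obtain ⟨H, hH, hb, hE⟩ := hf.exists_resolved 𝒞 b M
    refine hE Vs ?_
    cases H with
    | bvar i => exact i.elim0
    | fvar x => simp [Tm.bind, hf.unassigned x (hH x rfl), hM] at hb
    | cst c => cases hb.trans hM
    | lam P =>
      obtain ⟨V, Vs, rfl, rfl, rfl⟩ := List.map_eq_cons_iff.mp hVs
      obtain ⟨x, hx⟩ := exists_fresh 𝒞 𝒜 ((Tm.app (.lam P) V).apps Vs)
      obtain ⟨hP, hV, hVs⟩ := hx.notMem_FV_redex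
      obtain ⟨e₁, e₂⟩ := bind_update_of_notMem_FV (f := f) hP hVs
      cases hb.trans hM
      -- By `e₁` and `e₂`, the configuration extended by `x` unfolds to the contracted body and the
      -- old stack.
      exact .beta hx (ih (hf.snoc hx.dom hx.mctx hV) e₁ e₂)
    | app P Q => cases hb.trans hM
    | ifte P Q R => cases hb.trans hM
  | @ifZero T T₀ T₁ Ts b _ _ ih₁ ih₂ =>
    obtain ⟨H, hH, hb, hE⟩ := hf.exists_resolved 𝒞 b M
    refine hE Vs ?_
    cases H with
    | bvar i => exact i.elim0
    | fvar x => simp [Tm.bind, hf.unassigned x (hH x rfl), hM] at hb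
    | cst c => cases hb.trans hM
    | lam P => cases hb.trans hM
    | app P Q => cases hb.trans hM
    | ifte P Q R =>
      cases hb.trans hM
      -- The test runs on an empty stack in a larger B-context, which is why the induction is
      -- uniform in `𝒞`.
      exact .ifZero (ih₁ hf (Vs := []) rfl rfl) (ih₂ hf rfl hVs)
  | @ifOne T T₀ T₁ Ts b _ _ ih₁ ih₂ =>
    obtain ⟨H, hH, hb, hE⟩ := hf.exists_resolved 𝒞 b M
    refine hE Vs ?_
    cases H with
    | bvar i => exact i.elim0
    | fvar x => simp [Tm.bind, hf.unassigned x (hH x rfl), hM] at hb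
    | cst c => cases hb.trans hM
    | lam P => cases hb.trans hM
    | app P Q => cases hb.trans hM
    | ifte P Q R =>
      cases hb.trans hM
      exact .ifOne (ih₁ hf (Vs := []) rfl rfl) (ih₂ hf rfl hVs)

end STAB

theorem mainTheorem5 (M : STAB.Term) (hM : STAB.IsProgram M) (b : STAB.BConst) :
    (STAB.Evaluates M b → STAB.RedStar M (.cst b)) ∧
      (STAB.RedStar M (.cst b) → STAB.Evaluates M b) :=
  ⟨fun h => h.redStar, fun h => (STAB.StackEval.of_whRedStar h.whRedStar_cst).eval
    STAB.Unfolding.empty (Vs := []) (STAB.Tm.bind_fvar_bvar M) rfl⟩
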